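/- Let $\mathbb H$ be the skew field of quaternions, $\mathbb S=\{q\in\mathbb H : q^2=-1\}$, and let $\mathsf H$ be a quaternionic Hilbert space, i.e. a right $\mathbb H$-module, complete for the norm $\|u\|=\sqrt{\langle u|u\rangle}$, with a Hermitian $\mathbb H$-valued scalar product $\langle\cdot|\cdot\rangle$ that is right $\mathbb H$-linear in the second variable. Let $\mathfrak B(\mathsf H)$ be the set of bounded right $\mathbb H$-linear operators $\mathsf H\to\mathsf H$, $\mathrm I$ the identity operator, and let $T^*$ denote the adjoint of $T$, so $\langle T^*u|v\rangle=\langle u|Tv\rangle$. For $T\in\mathfrak B(\mathsf H)$ and $q\in\mathbb H$ put $\Delta_q(T)=T^2-T(q+\overline q)+\mathrm I|q|^2$. The spherical spectrum $\sigma_S(T)\subset\mathbb H$ is the complement of the set of all $q\in\mathbb H$ such that $\Delta_q(T)$ is injective, has dense range, and has a bounded inverse $\mathrm{Ran}(\Delta_q(T))\to\mathsf H$. For $\imath\in\mathbb S$ put $\mathbb C_\imath=\{\alpha+\imath\beta : \alpha,\beta\in\mathbb R\}$, identified with $\mathbb C$ via $\alpha+i\beta\mapsto\alpha+\imath\beta$.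 For $\mathcal K\subset\mathbb C$ the circularization of $\mathcal K$ is $\Omega_{\mathcal K}=\{\alpha+\jmath\beta : \alpha,\beta\in\mathbb R,\ \alpha+i\beta\in\mathcal K,\ \jmath\in\mathbb S\}\subset\mathbb H$. Let $T\in\mathfrak B(\mathsf H)$ be normal ($TT^*=T^*T$), let $J\in\mathfrak B(\mathsf H)$ be anti-self-adjoint ($J^*=-J$) and unitary ($JJ^*=J^*J=\mathrm I$) with $TJ=JT$ and $T^*J=JT^*$, and let $\imath\in\mathbb S$. Put $\mathsf H_\pm^{J\imath}=\{u\in\mathsf H : Ju=\pm u\imath\}$; with the right multiplication by $\mathbb C_\imath\cong\mathbb C$ and the scalar product of $\mathsf H$ (which is $\mathbb C_\imath$-valued there), these are complex Hilbert spaces. Then: (a) $T(\mathsf H_+^{J\imath})\subset\mathsf H_+^{J\imath}$ and $T^*(\mathsf H_+^{J\imath})\subset\mathsf H_+^{J\imath}$. Moreover, the restrictions $T|_{\mathsf H_+^{J\imath}}$ and $T^*|_{\mathsf H_+^{J\imath}}$, which are bounded complex linear operators of $\mathsf H_+^{J\imath}$, satisfy, with $\sigma$ denoting the usual spectrum of a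 bounded operator on a complex Hilbert space: (b) $(T|_{\mathsf H_+^{J\imath}})^*=T^*|_{\mathsf H_+^{J\imath}}$. (c) $\sigma(T|_{\mathsf H_+^{J\imath}})\cup\overline{\sigma(T|_{\mathsf H_+^{J\imath}})}=\sigma_S(T)\cap\mathbb C_\imath$, where the bar is complex conjugation and the left-hand side is viewed as a subset of $\mathbb C_\imath$ via $\mathbb C\cong\mathbb C_\imath$. (d) $\sigma_S(T)=\Omega_{\mathcal K}$ with $\mathcal K=\sigma(T|_{\mathsf H_+^{J\imath}})$. The same statements (a)–(d) hold with $\mathsf H_-^{J\imath}$ in place of $\mathsf H_+^{J\imath}$. -/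

import Mathlib

open scoped Quaternion

/-- A quaternionic pre-Hilbert space: a right module over the quaternions, i.e. a module over the
opposite ring (so that `u q` is `MulOpposite.op q • u`), with a Hermitian quaternionic scalar product
that is right linear in the second variable and induces the norm `‖u‖ = √⟨u|u⟩`. A quaternionic
Hilbert space is one that is complete. -/
class QuaternionicInnerProductSpace (H : Type*) [NormedAddCommGroup H] [Module ℍᵐᵒᵖ H]
    extends Inner ℍ H where
  inner_add_right (u v w : H) : inner u (v + w) = inner u v + inner u w
  inner_smul_right (u v : H) (q : ℍ) : inner u (MulOpposite.op q • v) = inner u v * q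
  star_inner (u v : H) : star (inner v u) = inner u v
  inner_self (u : H) : inner u u = ((‖u‖ ^ 2 : ℝ) : ℍ)

namespace QuaternionicHilbert

variable {H : Type*} [NormedAddCommGroup H] [Module ℍᵐᵒᵖ H] [QuaternionicInnerProductSpace H]

section Basic

theorem inner_add_left (u v w : H) : inner ℍ (u + v) w = inner ℍ u w + inner ℍ v w := by
  rw [← QuaternionicInnerProductSpace.star_inner, QuaternionicInnerProductSpace.inner_add_right,
    star_add, QuaternionicInnerProductSpace.star_inner, QuaternionicInnerProductSpace.star_inner]

theorem inner_smul_left (u v : H) (q : ℍ) :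
    inner ℍ (MulOpposite.op q • u) v = star q * inner ℍ u v := by
  rw [← QuaternionicInnerProductSpace.star_inner, QuaternionicInnerProductSpace.inner_smul_right,
    star_mul, QuaternionicInnerProductSpace.star_inner]

theorem inner_neg_left (u v : H) : inner ℍ (-u) v = -inner ℍ u v := by
  have h := inner_smul_left u v (-1)
  simpa using h

theorem norm_op_smul (q : ℍ) (u : H) : ‖MulOpposite.op q • u‖ = ‖u‖ * ‖q‖ := by
  have h : (((‖MulOpposite.op q • u‖ ^ 2 : ℝ)) : ℍ) = (((‖u‖ * ‖q‖) ^ 2 : ℝ) : ℍ) := by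
    rw [← QuaternionicInnerProductSpace.inner_self, QuaternionicInnerProductSpace.inner_smul_right,
      inner_smul_left, QuaternionicInnerProductSpace.inner_self, mul_assoc,
      Quaternion.coe_commutes, ← mul_assoc, Quaternion.star_mul_self,
      Quaternion.normSq_eq_norm_mul_self, ← Quaternion.coe_mul]
    congr 1
    ring
  have h' := Quaternion.coe_injective h
  exact (sq_eq_sq₀ (norm_nonneg _) (by positivity)).1 h'

theorem continuous_op_smul (q : ℍ) : Continuous fun u : H => MulOpposite.op q • u := by
  refine AddMonoidHomClass.continuous_of_bound
    (DistribSMul.toAddMonoidHom H (MulOpposite.op q)) ‖q‖ fun u => ?_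
  rw [mul_comm]
  exact (norm_op_smul q u).le

end Basic

section Adjoint

/-- The real Hilbert space underlying a quaternionic Hilbert space (used only to construct
adjoints). -/
noncomputable abbrev realInnerProductSpace (H : Type*) [NormedAddCommGroup H] [Module ℍᵐᵒᵖ H]
    [QuaternionicInnerProductSpace H] : InnerProductSpace ℝ H :=
  { Module.compHom H (algebraMap ℝ ℍᵐᵒᵖ) with
    norm_smul_le := fun r u => by
      change ‖MulOpposite.op ((r : ℝ) : ℍ) • u‖ ≤ _
      rw [norm_op_smul, Quaternion.norm_coe, mul_comm]
    inner := fun u v => (inner ℍ u v).re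
    norm_sq_eq_re_inner := fun u => by
      change _ = (inner ℍ u u).re
      rw [QuaternionicInnerProductSpace.inner_self, Quaternion.re_coe]
    conj_inner_symm := fun u v => by
      change (inner ℍ v u).re = (inner ℍ u v).re
      rw [← QuaternionicInnerProductSpace.star_inner u v, Quaternion.re_star]
    add_left := fun u v w => by
      change (inner ℍ (u + v) w).re = (inner ℍ u w).re + (inner ℍ v w).re
      rw [inner_add_left, Quaternion.re_add]
    smul_left := fun u v r => by
      change (inner ℍ (MulOpposite.op ((r : ℝ) : ℍ) • u) v).re = r * (inner ℍ u v).re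
      rw [inner_smul_left, Quaternion.star_coe, Quaternion.coe_mul_eq_smul, Quaternion.re_smul,
        smul_eq_mul] }

theorem eq_of_forall_re_mul {a b : ℍ} (h : ∀ q : ℍ, (a * q).re = (b * q).re) : a = b := by
  have h1 : ((a - b) * star (a - b)).re = 0 := by
    rw [sub_mul, Quaternion.re_sub, h, sub_self]
  rw [Quaternion.self_mul_star, Quaternion.re_coe, Quaternion.normSq_eq_zero] at h1
  exact sub_eq_zero.1 h1

theorem ext_inner {u w : H} (h : ∀ v, inner ℍ u v = inner ℍ w v) : u = w := by
  have h1 : inner ℍ (u - w) (u - w) = 0 := by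
    rw [sub_eq_add_neg u w, inner_add_left, inner_neg_left, h, add_neg_cancel]
  rw [QuaternionicInnerProductSpace.inner_self] at h1
  have h2 : ‖u - w‖ ^ 2 = 0 := Quaternion.coe_injective (by simpa using h1)
  exact sub_eq_zero.1 (norm_eq_zero.1 (pow_eq_zero_iff two_ne_zero |>.1 h2))

theorem exists_adjoint [CompleteSpace H] (T : H →L[ℍᵐᵒᵖ] H) :
    ∃ S : H →L[ℍᵐᵒᵖ] H, ∀ u v, inner ℍ (S u) v = inner ℍ u (T v) := by
  let _ : InnerProductSpace ℝ H := realInnerProductSpace H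
  let R : H →L[ℝ] H :=
    { toFun := T
      map_add' := T.map_add
      map_smul' := fun r u => T.map_smul (MulOpposite.op (r : ℍ)) u
      cont := T.continuous }
  have key : ∀ u v, inner ℍ (ContinuousLinearMap.adjoint R u) v = inner ℍ u (T v) := by
    intro u v
    refine eq_of_forall_re_mul fun q => ?_
    have h : inner ℝ (ContinuousLinearMap.adjoint R u) (MulOpposite.op q • v)
        = inner ℝ u (R (MulOpposite.op q • v)) := ContinuousLinearMap.adjoint_inner_left R _ _
    have h' : (inner ℍ (ContinuousLinearMap.adjoint R u) (MulOpposite.op q • v)).re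
        = (inner ℍ u (T (MulOpposite.op q • v))).re := h
    rwa [T.map_smul, QuaternionicInnerProductSpace.inner_smul_right,
      QuaternionicInnerProductSpace.inner_smul_right] at h'
  refine ⟨{ toFun := ContinuousLinearMap.adjoint R
            map_add' := (ContinuousLinearMap.adjoint R).map_add
            map_smul' := fun q u => ?_
            cont := (ContinuousLinearMap.adjoint R).continuous }, key⟩
  refine ext_inner fun v => ?_
  obtain ⟨q, rfl⟩ := MulOpposite.op_surjective q
  rw [key, RingHom.id_apply, inner_smul_left, inner_smul_left, key]

/-- The adjoint `T*` of a bounded right linear operator `T`. -/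
noncomputable def adjoint [CompleteSpace H] (T : H →L[ℍᵐᵒᵖ] H) : H →L[ℍᵐᵒᵖ] H :=
  (exists_adjoint T).choose

/-- The property that characterizes the adjoint. -/
theorem adjoint_inner_left [CompleteSpace H] (T : H →L[ℍᵐᵒᵖ] H) (u v : H) :
    inner ℍ (adjoint T u) v = inner ℍ u (T v) :=
  (exists_adjoint T).choose_spec u v

end Adjoint

section SphericalSpectrum

/-- The operator `I r : u ↦ u r` for a real number `r`. -/
noncomputable def realScalar (H : Type*) [NormedAddCommGroup H] [Module ℍᵐᵒᵖ H]
    [QuaternionicInnerProductSpace H] (r : ℝ) : H →L[ℍᵐᵒᵖ] H where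
  toFun u := MulOpposite.op (r : ℍ) • u
  map_add' u v := smul_add _ u v
  map_smul' q u := by
    obtain ⟨q, rfl⟩ := MulOpposite.op_surjective q
    rw [RingHom.id_apply, smul_smul, smul_smul, ← MulOpposite.op_mul, ← MulOpposite.op_mul,
      Quaternion.coe_commutes]
  cont := continuous_op_smul _

/-- `Δ_q(T) = T² - T (q + q̄) + I |q|²`; the quaternion `q + q̄` is real. -/
noncomputable def sphericalDelta (q : ℍ) (T : H →L[ℍᵐᵒᵖ] H) : H →L[ℍᵐᵒᵖ] H :=
  T * T - T * realScalar H (q + star q).re + realScalar H (‖q‖ ^ 2)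

/-- The spherical resolvent set: `Δ_q(T)` is injective, has dense range, and its inverse, defined on
its range, is bounded. -/
def sphericalResolventSet (T : H →L[ℍᵐᵒᵖ] H) : Set ℍ :=
  {q | (∀ u, sphericalDelta q T u = 0 → u = 0) ∧
    DenseRange (sphericalDelta q T) ∧
    ∃ K : ℝ, ∀ u, ‖u‖ ≤ K * ‖sphericalDelta q T u‖}

/-- The spherical spectrum `σ_S(T)`. -/
def sphericalSpectrum (T : H →L[ℍᵐᵒᵖ] H) : Set ℍ :=
  (sphericalResolventSet T)ᶜ

end SphericalSpectrum

section Slices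

/-- The sphere `𝕊` of quaternionic imaginary units. -/
abbrev ImagUnit : Type := {q : ℍ // q * q = -1}

/-- The identification `ℂ → ℂ_ι`, `α + iβ ↦ α + ιβ`. -/
noncomputable def toSlice (ι : ImagUnit) (z : ℂ) : ℍ := (z.re : ℍ) + (ι : ℍ) * (z.im : ℍ)

/-- The subset `ℂ_ι = {α + ιβ | α, β ∈ ℝ}` of `ℍ`. -/
def slice (ι : ImagUnit) : Set ℍ := {q | ∃ α β : ℝ, q = (α : ℍ) + (ι : ℍ) * (β : ℍ)}

/-- The circularization `Ω_K = {α + jβ | α + iβ ∈ K, j ∈ 𝕊}` of a subset `K` of `ℂ`. -/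
def circularization (K : Set ℂ) : Set ℍ :=
  {q | ∃ (α β : ℝ) (j : ImagUnit), (⟨α, β⟩ : ℂ) ∈ K ∧ q = (α : ℍ) + (j : ℍ) * (β : ℍ)}

/-- The real linear projection of `ℍ` onto `ℂ_ι ≃ ℂ`; it is the inverse of `toSlice ι` on `ℂ_ι`
(see `toSlice_ofSlice`). -/
noncomputable def ofSlice (ι : ImagUnit) (q : ℍ) : ℂ := ⟨q.re, -((ι : ℍ) * q).re⟩

theorem ImagUnit.re_eq_zero (ι : ImagUnit) : (ι : ℍ).re = 0 := by
  obtain ⟨q, hq⟩ := ι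
  have h0 := congrArg QuaternionAlgebra.re hq
  have h1 := congrArg QuaternionAlgebra.imI hq
  have h2 := congrArg QuaternionAlgebra.imJ hq
  have h3 := congrArg QuaternionAlgebra.imK hq
  simp only [Quaternion.re_mul, Quaternion.imI_mul, Quaternion.imJ_mul, Quaternion.imK_mul,
    Quaternion.re_neg, Quaternion.imI_neg, Quaternion.imJ_neg, Quaternion.imK_neg,
    Quaternion.re_one, Quaternion.imI_one, Quaternion.imJ_one, Quaternion.imK_one] at h0 h1 h2 h3
  change q.re = 0
  by_contra hr
  have e1 : q.imI = 0 := by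
    have : q.re * q.imI = 0 := by linarith
    exact (mul_eq_zero.1 this).resolve_left hr
  have e2 : q.imJ = 0 := by
    have : q.re * q.imJ = 0 := by linarith
    exact (mul_eq_zero.1 this).resolve_left hr
  have e3 : q.imK = 0 := by
    have : q.re * q.imK = 0 := by linarith
    exact (mul_eq_zero.1 this).resolve_left hr
  rw [e1, e2, e3] at h0
  nlinarith [mul_self_nonneg q.re]

theorem ImagUnit.star_eq (ι : ImagUnit) : star (ι : ℍ) = -(ι : ℍ) :=
  Quaternion.star_eq_neg.2 ι.re_eq_zero

theorem toSlice_one (ι : ImagUnit) : toSlice ι 1 = 1 := by simp [toSlice]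

theorem toSlice_zero (ι : ImagUnit) : toSlice ι 0 = 0 := by simp [toSlice]

theorem toSlice_add (ι : ImagUnit) (z w : ℂ) : toSlice ι (z + w) = toSlice ι z + toSlice ι w := by
  simp only [toSlice, Complex.add_re, Complex.add_im, Quaternion.coe_add, mul_add]
  abel

theorem toSlice_mul (ι : ImagUnit) (z w : ℂ) : toSlice ι (z * w) = toSlice ι z * toSlice ι w := by
  have h : (ι : ℍ) * (z.im : ℍ) * ((ι : ℍ) * (w.im : ℍ)) = -((z.im : ℍ) * (w.im : ℍ)) := by
    rw [mul_assoc, ← mul_assoc (z.im : ℍ), Quaternion.coe_commutes z.im, mul_assoc, ← mul_assoc,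
      ι.2, neg_one_mul]
  have h' : (z.re : ℍ) * ((ι : ℍ) * (w.im : ℍ)) = (ι : ℍ) * ((z.re : ℍ) * (w.im : ℍ)) := by
    rw [← mul_assoc, Quaternion.coe_commutes, mul_assoc]
  simp only [toSlice, Complex.mul_re, Complex.mul_im, Quaternion.coe_add, Quaternion.coe_sub,
    Quaternion.coe_mul, add_mul, mul_add, h, h']
  rw [mul_assoc]
  abel

theorem ofSlice_star (ι : ImagUnit) (q : ℍ) : ofSlice ι (star q) = star (ofSlice ι q) := by
  apply Complex.ext
  · simp [ofSlice]
  · have h := ι.re_eq_zero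
    simp [ofSlice, Quaternion.re_mul, h]
    ring

theorem ofSlice_mul (ι : ImagUnit) (z : ℂ) (q : ℍ) :
    ofSlice ι (star (toSlice ι z) * q) = star z * ofSlice ι q := by
  have h : (ι : ℍ) * (star (toSlice ι z) * q) = (z.re : ℍ) * ((ι : ℍ) * q) + (z.im : ℍ) * q := by
    have e : star (toSlice ι z) = (z.re : ℍ) - (z.im : ℍ) * (ι : ℍ) := by
      simp [toSlice, ι.star_eq, sub_eq_add_neg]
    rw [e, sub_mul, mul_sub, ← mul_assoc, ← Quaternion.coe_commutes, mul_assoc,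
      mul_assoc (z.im : ℍ), ← mul_assoc (ι : ℍ), ← Quaternion.coe_commutes,
      mul_assoc (z.im : ℍ), ← mul_assoc (ι : ℍ), ι.2]
    simp
  have h2 : star (toSlice ι z) * q = (z.re : ℍ) * q - (z.im : ℍ) * ((ι : ℍ) * q) := by
    simp [toSlice, ι.star_eq, sub_eq_add_neg, add_mul, mul_assoc]
  apply Complex.ext
  · simp only [ofSlice, h2, Quaternion.coe_mul_eq_smul, Quaternion.re_sub, Quaternion.re_smul]
    simp
    ring
  · simp only [ofSlice, h, Quaternion.coe_mul_eq_smul, Quaternion.re_add, Quaternion.re_smul]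
    simp
    ring

/-- A quaternion lies in `ℂ_ι` as soon as it commutes with `ι`. -/
theorem toSlice_ofSlice (ι : ImagUnit) {q : ℍ} (hq : (ι : ℍ) * q = q * (ι : ℍ)) :
    toSlice ι (ofSlice ι q) = q := by
  obtain ⟨ι, hι⟩ := ι
  have hr := ImagUnit.re_eq_zero ⟨ι, hι⟩
  change ι.re = 0 at hr
  change ι * q = q * ι at hq
  have h0 := congrArg QuaternionAlgebra.re hι
  have h1 := congrArg QuaternionAlgebra.imI hq
  have h2 := congrArg QuaternionAlgebra.imJ hq
  have h3 := congrArg QuaternionAlgebra.imK hq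
  simp only [Quaternion.re_mul, Quaternion.imI_mul, Quaternion.imJ_mul, Quaternion.imK_mul,
    Quaternion.re_neg, Quaternion.re_one, hr] at h0 h1 h2 h3
  apply Quaternion.ext
  · simp [toSlice, ofSlice, hr]
  · simp [toSlice, ofSlice, Quaternion.re_mul, hr]
    linear_combination (-q.imI) * h0 + ι.imJ / 2 * h3 - ι.imK / 2 * h2
  · simp [toSlice, ofSlice, Quaternion.re_mul, hr]
    linear_combination (-q.imJ) * h0 + ι.imK / 2 * h1 - ι.imI / 2 * h3
  · simp [toSlice, ofSlice, Quaternion.re_mul, hr]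
    linear_combination (-q.imK) * h0 + ι.imI / 2 * h2 - ι.imJ / 2 * h1

end Slices

section ComplexSubspaces

/-- The complex subspaces `H_±^{Jι} = {u | J u = ± u ι}` of `H`; the sign `ε = 1` gives `H_+^{Jι}`
and `ε = -1` gives `H_-^{Jι}`. -/
def complexSubspace (J : H →L[ℍᵐᵒᵖ] H) (ι : ImagUnit) (ε : ℤˣ) : AddSubgroup H where
  carrier := {u | J u = ε • (MulOpposite.op (ι : ℍ) • u)}
  zero_mem' := by simp
  add_mem' {u v} hu hv := by
    simp only [Set.mem_ofPred_eq] at hu hv ⊢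
    rw [map_add, hu, hv, smul_add, smul_add]
  neg_mem' {u} hu := by
    simp only [Set.mem_ofPred_eq] at hu ⊢
    rw [map_neg, hu, smul_neg, smul_neg]

variable {J : H →L[ℍᵐᵒᵖ] H} {ι : ImagUnit} {ε : ℤˣ}

theorem mem_complexSubspace {u : H} :
    u ∈ complexSubspace J ι ε ↔ J u = ε • (MulOpposite.op (ι : ℍ) • u) := Iff.rfl

theorem op_smul_mem (z : ℂ) {u : H} (hu : u ∈ complexSubspace J ι ε) :
    MulOpposite.op (toSlice ι z) • u ∈ complexSubspace J ι ε := by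
  rw [mem_complexSubspace] at hu ⊢
  have h : toSlice ι z * (ι : ℍ) = (ι : ℍ) * toSlice ι z := by
    simp only [toSlice, add_mul, mul_add, Quaternion.coe_commutes, mul_assoc]
  rw [map_smul, hu, smul_comm, smul_smul, smul_smul, ← MulOpposite.op_mul, ← MulOpposite.op_mul, h]

/-- The complex Hilbert space structure of `H_±^{Jι}`: the norm is that of `H`, the complex scalar
multiplication is the right multiplication by `ℂ_ι ≃ ℂ`, and the scalar product is the one of `H`,
which is `ℂ_ι`-valued when `J* = -J` (see `toSlice_inner`). -/
noncomputable instance : InnerProductSpace ℂ (complexSubspace J ι ε) where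
  smul z u := ⟨MulOpposite.op (toSlice ι z) • (u : H), op_smul_mem z u.2⟩
  one_smul u := Subtype.ext <| by
    change MulOpposite.op (toSlice ι 1) • (u : H) = u
    rw [toSlice_one, MulOpposite.op_one, one_smul]
  mul_smul z w u := Subtype.ext <| by
    change MulOpposite.op (toSlice ι (z * w)) • (u : H)
      = MulOpposite.op (toSlice ι z) • (MulOpposite.op (toSlice ι w) • (u : H))
    rw [mul_comm z w, toSlice_mul, MulOpposite.op_mul, mul_smul]
  smul_zero z := Subtype.ext <| smul_zero (MulOpposite.op (toSlice ι z))
  smul_add z u v := Subtype.ext <| smul_add (MulOpposite.op (toSlice ι z)) (u : H) (v : H)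
  add_smul z w u := Subtype.ext <| by
    change MulOpposite.op (toSlice ι (z + w)) • (u : H)
      = MulOpposite.op (toSlice ι z) • (u : H) + MulOpposite.op (toSlice ι w) • (u : H)
    rw [toSlice_add, MulOpposite.op_add, add_smul]
  zero_smul u := Subtype.ext <| by
    change MulOpposite.op (toSlice ι 0) • (u : H) = 0
    rw [toSlice_zero, MulOpposite.op_zero, zero_smul]
  norm_smul_le z u := by
    change ‖MulOpposite.op (toSlice ι z) • (u : H)‖ ≤ ‖z‖ * ‖(u : H)‖
    have h : ‖toSlice ι z‖ = ‖z‖ := by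
      have h1 := ofSlice_mul ι z (toSlice ι z)
      rw [Quaternion.star_mul_self] at h1
      have h2 := congrArg Complex.re h1
      have h3 : ofSlice ι (toSlice ι z) = z := by
        apply Complex.ext
        · simp [ofSlice, toSlice, Quaternion.re_mul, ι.re_eq_zero]
        · simp only [ofSlice, toSlice, mul_add, ← mul_assoc, ι.2]
          simp [Quaternion.re_mul, ι.re_eq_zero]
      rw [h3] at h2
      simp only [ofSlice, Quaternion.re_coe, Quaternion.normSq_eq_norm_mul_self] at h2
      have h4 : ‖toSlice ι z‖ ^ 2 = ‖z‖ ^ 2 := by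
        rw [sq, h2, ← Complex.normSq_eq_norm_sq, Complex.normSq_apply]
        simp
      exact (sq_eq_sq₀ (norm_nonneg _) (norm_nonneg _)).1 h4
    rw [norm_op_smul, h, mul_comm]
  inner u v := ofSlice ι (inner ℍ (u : H) (v : H))
  norm_sq_eq_re_inner u := by
    change ‖(u : H)‖ ^ 2 = (inner ℍ (u : H) (u : H)).re
    rw [QuaternionicInnerProductSpace.inner_self, Quaternion.re_coe]
  conj_inner_symm u v := by
    change star (ofSlice ι (inner ℍ (v : H) (u : H))) = ofSlice ι (inner ℍ (u : H) (v : H))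
    rw [← ofSlice_star, QuaternionicInnerProductSpace.star_inner]
  add_left u v w := by
    change ofSlice ι (inner ℍ ((u : H) + (v : H)) (w : H))
      = ofSlice ι (inner ℍ (u : H) (w : H)) + ofSlice ι (inner ℍ (v : H) (w : H))
    rw [inner_add_left]
    apply Complex.ext
    · simp [ofSlice]
    · simp only [ofSlice, mul_add, Quaternion.re_add, neg_add, Complex.add_im]
  smul_left u v z := by
    change ofSlice ι (inner ℍ (MulOpposite.op (toSlice ι z) • (u : H)) (v : H))
      = star z * ofSlice ι (inner ℍ (u : H) (v : H))
    rw [inner_smul_left, ofSlice_mul]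

theorem coe_smul (z : ℂ) (u : complexSubspace J ι ε) :
    ((z • u : complexSubspace J ι ε) : H) = MulOpposite.op (toSlice ι z) • (u : H) := rfl

theorem toSlice_inner [CompleteSpace H] (hJ : adjoint J = -J) (u v : complexSubspace J ι ε) :
    toSlice ι (inner ℂ u v) = inner ℍ (u : H) (v : H) := by
  refine toSlice_ofSlice ι ?_
  have h := adjoint_inner_left J (u : H) (v : H)
  rw [hJ, neg_apply, mem_complexSubspace.1 u.2, mem_complexSubspace.1 v.2,
    inner_neg_left] at h
  rcases Int.units_eq_one_or ε with rfl | rfl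
  · rw [one_smul, one_smul, inner_smul_left, QuaternionicInnerProductSpace.inner_smul_right,
      ι.star_eq, neg_mul, neg_neg] at h
    exact h
  · have e : ∀ w : H, (-1 : ℤˣ) • (MulOpposite.op (ι : ℍ) • w) = MulOpposite.op (-(ι : ℍ)) • w := by
      intro w
      rw [Units.neg_smul, one_smul, MulOpposite.op_neg, neg_smul]
    rw [e, e, inner_smul_left, QuaternionicInnerProductSpace.inner_smul_right, star_neg,
      ι.star_eq, neg_neg, mul_neg, neg_inj] at h
    exact h

instance [CompleteSpace H] : CompleteSpace (complexSubspace J ι ε) := by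
  suffices h : IsClosed (complexSubspace J ι ε : Set H) from h.completeSpace_coe
  refine isClosed_eq J.continuous ?_
  rcases Int.units_eq_one_or ε with rfl | rfl
  · simpa using continuous_op_smul (H := H) (ι : ℍ)
  · simp only [Units.neg_smul, one_smul]
    exact (continuous_op_smul (H := H) (ι : ℍ)).neg

/-- The restriction to `H_±^{Jι}` of a bounded right linear operator that preserves it, as a bounded
complex linear operator. -/
noncomputable def restrict (J : H →L[ℍᵐᵒᵖ] H) (ι : ImagUnit) (ε : ℤˣ) (T : H →L[ℍᵐᵒᵖ] H)
    (hT : ∀ u ∈ complexSubspace J ι ε, T u ∈ complexSubspace J ι ε) :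
    complexSubspace J ι ε →L[ℂ] complexSubspace J ι ε where
  toFun u := ⟨T u, hT u u.2⟩
  map_add' u v := Subtype.ext <| T.map_add (u : H) (v : H)
  map_smul' z u := Subtype.ext <| T.map_smul (MulOpposite.op (toSlice ι z)) (u : H)
  cont := (T.continuous.comp continuous_subtype_val).subtype_mk _

end ComplexSubspaces

end QuaternionicHilbert

/-!
Since `J² = -1`, `H` is the direct sum of `H_+^{Jι}` and `H_-^{Jι}`, and right multiplication by a
nonzero quaternion anticommuting with `ι` exchanges the two summands. Hence a right linear operator
commuting with `J` is bijective on `H` as soon as it is so on one of them. By the bounded inverse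
theorem, `q` lies in `σ_S(T)` exactly when `Δ_q(T)` is not bijective, and for `q = α + jβ` and
`z = α + iβ` the restriction of `Δ_q(T)` is `(z - A)(z̄ - A)`, where `A` is the restriction of `T`.
So `q ∈ σ_S(T)` if and only if `z` or `z̄` is in `σ(A)`, whatever the imaginary unit `j`.
-/

namespace QuaternionicHilbert

section Algebra

open Function Set

theorem bijective_iff_bijOn_of_isCompl {G F : Type*} [AddCommGroup G] [FunLike F G G]
    [AddMonoidHomClass F G G] {A B : AddSubgroup G} (hAB : IsCompl A B) {f : F}
    (hA : MapsTo f A A) (hB : MapsTo f B B) :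
    Bijective f ↔ BijOn f A A ∧ BijOn f B B := by
  have eq_zero {a b : G} (ha : a ∈ A) (hb : b ∈ B) (hab : a + b = 0) : a = 0 ∧ b = 0 :=
    AddSubgroup.disjoint_iff_add_eq_zero.1 hAB.disjoint ha hb hab
  have exists_add (u : G) : ∃ a ∈ A, ∃ b ∈ B, a + b = u :=
    AddSubgroup.mem_sup.1 (hAB.sup_eq_top ▸ AddSubgroup.mem_top u)
  constructor
  · intro ⟨hinj, hsurj⟩
    refine ⟨⟨hA, hinj.injOn, fun v hv => ?_⟩, ⟨hB, hinj.injOn, fun v hv => ?_⟩⟩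
    · obtain ⟨u, rfl⟩ := hsurj v
      obtain ⟨a, ha, b, hb, rfl⟩ := exists_add u
      have hfb := (eq_zero (A.sub_mem (hA ha) hv) (hB hb) (by rw [map_add]; abel)).2
      exact ⟨a, ha, by rw [map_add, hfb, add_zero]⟩
    · obtain ⟨u, rfl⟩ := hsurj v
      obtain ⟨a, ha, b, hb, rfl⟩ := exists_add u
      have hfa := (eq_zero (hA ha) (B.sub_mem (hB hb) hv) (by rw [map_add]; abel)).1
      exact ⟨b, hb, by rw [map_add, hfa, zero_add]⟩
  · intro ⟨hfA, hfB⟩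
    refine ⟨(injective_iff_map_eq_zero f).2 fun u hu => ?_, fun v => ?_⟩
    · obtain ⟨a, ha, b, hb, rfl⟩ := exists_add u
      obtain ⟨hfa, hfb⟩ := eq_zero (hA ha) (hB hb) (by rw [← map_add, hu])
      rw [hfA.injOn ha A.zero_mem (hfa.trans (map_zero f).symm),
        hfB.injOn hb B.zero_mem (hfb.trans (map_zero f).symm), add_zero]
    · obtain ⟨a, ha, b, hb, rfl⟩ := exists_add v
      obtain ⟨x, -, rfl⟩ := hfA.surjOn ha
      obtain ⟨y, -, rfl⟩ := hfB.surjOn hb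
      exact ⟨x + y, map_add f x y⟩

theorem isUnit_mul_self_sub_add_iff_notMem_spectrum {R A : Type*} [CommSemiring R] [Ring A]
    [Algebra R A] (a : A) (r s : R) :
    IsUnit (a * a - (r + s) • a + algebraMap R A (r * s)) ↔
      r ∉ spectrum R a ∧ s ∉ spectrum R a := by
  have factor : a * a - (r + s) • a + algebraMap R A (r * s)
      = (algebraMap R A r - a) * (algebraMap R A s - a) := by
    rw [add_smul, Algebra.smul_def, Algebra.smul_def, map_mul, sub_mul, mul_sub, mul_sub,
      ← Algebra.commutes s a]
    abel
  have hcomm : Commute (algebraMap R A r - a) (algebraMap R A s - a) :=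
    (Algebra.commute_algebraMap_left r _).sub_left
      ((Algebra.commute_algebraMap_right s a).sub_right (Commute.refl a))
  rw [factor, hcomm.isUnit_mul_iff, spectrum.notMem_iff, spectrum.notMem_iff]

end Algebra

section Slices

instance : Neg ImagUnit where
  neg j := ⟨-(j : ℍ), by rw [neg_mul_neg, j.2]⟩

instance : Nonempty ImagUnit := by
  obtain ⟨i, hre, hI, hJ, hK⟩ : ∃ i : ℍ, i.re = 0 ∧ i.imI = 1 ∧ i.imJ = 0 ∧ i.imK = 0 :=
    ⟨⟨0, 1, 0, 0⟩, rfl, rfl, rfl, rfl⟩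
  exact ⟨i, by apply Quaternion.ext <;> simp [hre, hI, hJ, hK]⟩

theorem toSlice_ofReal (j : ImagUnit) (r : ℝ) : toSlice j (r : ℂ) = (r : ℍ) := by
  simp [toSlice]

theorem toSlice_conj (j : ImagUnit) (z : ℂ) : toSlice j (starRingEnd ℂ z) = toSlice (-j) z := by
  change _ = _ + -(j : ℍ) * _
  rw [toSlice, Complex.conj_re, Complex.conj_im, Quaternion.coe_neg, mul_neg, neg_mul]

theorem star_toSlice (j : ImagUnit) (z : ℂ) : star (toSlice j z) = toSlice j (starRingEnd ℂ z) := by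
  simp [toSlice, j.star_eq, Quaternion.coe_commutes]

theorem toSlice_add_star (j : ImagUnit) (z : ℂ) :
    toSlice j z + star (toSlice j z) = ((2 * z.re : ℝ) : ℍ) := by
  rw [star_toSlice, ← toSlice_add, Complex.add_conj, toSlice_ofReal]

theorem norm_toSlice (j : ImagUnit) (z : ℂ) : ‖toSlice j z‖ = ‖z‖ := by
  have h : ((‖toSlice j z‖ * ‖toSlice j z‖ : ℝ) : ℍ) = ((‖z‖ ^ 2 : ℝ) : ℍ) := by
    rw [← Quaternion.normSq_eq_norm_mul_self, ← Quaternion.self_mul_star, star_toSlice,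
      ← toSlice_mul, Complex.mul_conj, Complex.normSq_eq_norm_sq, toSlice_ofReal]
  rw [← sq_eq_sq₀ (norm_nonneg _) (norm_nonneg _), sq, Quaternion.coe_injective h]

theorem exists_toSlice_eq (q : ℍ) : ∃ (j : ImagUnit) (z : ℂ), toSlice j z = q := by
  rcases eq_or_ne q.im 0 with him | him
  · refine ⟨Classical.arbitrary ImagUnit, (q.re : ℂ), ?_⟩
    rw [toSlice_ofReal, ← add_zero (q.re : ℍ), ← him, Quaternion.re_add_im]
  · have hnorm : ‖q.im‖ ≠ 0 := norm_ne_zero_iff.2 him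
    have hsq : (‖q.im‖⁻¹ • q.im) * (‖q.im‖⁻¹ • q.im) = -1 := by
      rw [smul_mul_smul_comm, ← sq q.im, Quaternion.im_sq, Quaternion.normSq_eq_norm_mul_self,
        smul_neg, ← Quaternion.coe_smul, smul_eq_mul, ← mul_inv,
        inv_mul_cancel₀ (mul_self_ne_zero.2 hnorm), Quaternion.coe_one]
    refine ⟨⟨‖q.im‖⁻¹ • q.im, hsq⟩, ⟨q.re, ‖q.im‖⟩, ?_⟩
    rw [toSlice, Quaternion.mul_coe_eq_smul, smul_inv_smul₀ hnorm, Quaternion.re_add_im]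

theorem slice_eq_range_toSlice (ι : ImagUnit) : slice ι = Set.range (toSlice ι) := by
  ext q
  constructor
  · rintro ⟨α, β, rfl⟩
    exact ⟨⟨α, β⟩, rfl⟩
  · rintro ⟨z, rfl⟩
    exact ⟨z.re, z.im, rfl⟩

theorem mem_circularization_iff {K : Set ℂ} {q : ℍ} :
    q ∈ circularization K ↔ ∃ (j : ImagUnit), ∃ z ∈ K, toSlice j z = q := by
  constructor
  · rintro ⟨α, β, j, hz, rfl⟩
    exact ⟨j, ⟨α, β⟩, hz, rfl⟩
  · rintro ⟨j, z, hz, rfl⟩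
    exact ⟨z.re, z.im, j, hz, rfl⟩

theorem eq_circularization_of_preimage_toSlice {S : Set ℍ} {K : Set ℂ}
    (hS : ∀ j : ImagUnit, toSlice j ⁻¹' S = K ∪ starRingEnd ℂ '' K) : S = circularization K := by
  ext q
  rw [mem_circularization_iff]
  constructor
  · intro hq
    obtain ⟨j, z, rfl⟩ := exists_toSlice_eq q
    have hz : z ∈ K ∪ starRingEnd ℂ '' K := hS j ▸ hq
    rcases hz with hz | ⟨w, hw, rfl⟩
    · exact ⟨j, z, hz, rfl⟩
    · exact ⟨-j, w, hw, (toSlice_conj j w).symm⟩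
  · rintro ⟨j, z, hz, rfl⟩
    have hz' : z ∈ toSlice j ⁻¹' S := hS j ▸ Or.inl hz
    exact hz'

theorem semiconjBy_neg_of_orthogonal (ι : ImagUnit) {p : ℍ} (hre : p.re = 0)
    (horth : p.imI * (ι : ℍ).imI + p.imJ * (ι : ℍ).imJ + p.imK * (ι : ℍ).imK = 0) :
    SemiconjBy p (ι : ℍ) (-(ι : ℍ)) := by
  apply Quaternion.ext <;>
    simp only [Quaternion.re_mul, Quaternion.imI_mul, Quaternion.imJ_mul, Quaternion.imK_mul,
      Quaternion.re_neg, Quaternion.imI_neg, Quaternion.imJ_neg, Quaternion.imK_neg, hre,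
      ι.re_eq_zero] <;>
    linarith

theorem exists_ne_zero_semiconjBy_neg (ι : ImagUnit) :
    ∃ p : ℍ, p ≠ 0 ∧ SemiconjBy p (ι : ℍ) (-(ι : ℍ)) := by
  by_cases hI : (ι : ℍ).imI = 0
  · exact ⟨⟨0, 1, 0, 0⟩, fun h => one_ne_zero (congrArg QuaternionAlgebra.imI h),
      semiconjBy_neg_of_orthogonal ι rfl (by simp [hI])⟩
  · exact ⟨⟨0, -(ι : ℍ).imJ, (ι : ℍ).imI, 0⟩, fun h => hI (congrArg QuaternionAlgebra.imJ h),
      semiconjBy_neg_of_orthogonal ι rfl (by ring)⟩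

end Slices

section ComplexSubspaces

open Function Set

theorem op_smul_op_smul_self {G : Type*} [AddCommGroup G] [Module ℍᵐᵒᵖ G]
    (ι : ImagUnit) (u : G) :
    MulOpposite.op (ι : ℍ) • MulOpposite.op (ι : ℍ) • u = -u := by
  rw [smul_smul, ← MulOpposite.op_mul, ι.2, MulOpposite.op_neg, MulOpposite.op_one, neg_smul,
    one_smul]

variable {H : Type*} [NormedAddCommGroup H] [Module ℍᵐᵒᵖ H] {J D : H →L[ℍᵐᵒᵖ] H}

theorem map_mem_complexSubspace {ι : ImagUnit} {ε : ℤˣ} (hD : Commute D J) {u : H}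
    (hu : u ∈ complexSubspace J ι ε) : D u ∈ complexSubspace J ι ε := by
  have hJu : J u = ε • (MulOpposite.op (ι : ℍ) • u) := hu
  calc J (D u) = D (J u) := (DFunLike.congr_fun hD.eq u).symm
    _ = ε • (MulOpposite.op (ι : ℍ) • D u) := by
      rw [hJu, Units.smul_def, map_zsmul, map_smul, Units.smul_def]

theorem sub_smul_map_mem_complexSubspace (hJ : J * J = -1) (ι : ImagUnit) (ε : ℤˣ) (u : H) :
    u - ε • (MulOpposite.op (ι : ℍ) • J u) ∈ complexSubspace J ι ε := by
  have hJJ : J (J u) = -u := DFunLike.congr_fun hJ u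
  change J _ = _
  calc J (u - ε • (MulOpposite.op (ι : ℍ) • J u))
    _ = J u + ε • (MulOpposite.op (ι : ℍ) • u) := by
      rw [map_sub, Units.smul_def, map_zsmul, map_smul, hJJ, ← Units.smul_def, smul_neg, smul_neg,
        sub_neg_eq_add]
    _ = ε • (MulOpposite.op (ι : ℍ) • (u - ε • (MulOpposite.op (ι : ℍ) • J u))) := by
      rw [smul_sub, smul_sub, smul_comm _ ε, op_smul_op_smul_self, smul_smul, Int.units_mul_self,
        one_smul, sub_neg_eq_add, add_comm]

theorem isCompl_complexSubspace_neg (hJ : J * J = -1) (ι : ImagUnit) (ε : ℤˣ) :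
    IsCompl (complexSubspace J ι ε) (complexSubspace J ι (-ε)) := by
  have : CharZero ℍᵐᵒᵖ := Algebra.charZero_of_charZero ℝ ℍᵐᵒᵖ
  constructor
  · refine AddSubgroup.disjoint_def.2 fun {u} hu hu' => ?_
    have h : ε • (MulOpposite.op (ι : ℍ) • u) = -ε • (MulOpposite.op (ι : ℍ) • u) :=
      Eq.trans (Eq.symm hu) hu'
    rw [Units.neg_smul, eq_neg_iff_add_eq_zero, ← two_smul ℍᵐᵒᵖ] at h
    have h' := (smul_eq_zero_iff_right (two_ne_zero (α := ℍᵐᵒᵖ))).1 h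
    rw [smul_eq_zero_iff_eq] at h'
    rw [← neg_eq_zero, ← op_smul_op_smul_self ι, h', smul_zero]
  · refine codisjoint_iff.2 ((AddSubgroup.eq_top_iff' _).2 fun u => ?_)
    have half : ∃ w : H, w + w = u := by
      refine ⟨(2⁻¹ : ℍᵐᵒᵖ) • u, ?_⟩
      rw [← two_smul ℍᵐᵒᵖ, smul_inv_smul₀ two_ne_zero]
    obtain ⟨w, rfl⟩ := half
    refine AddSubgroup.mem_sup.2 ⟨_, sub_smul_map_mem_complexSubspace hJ ι ε w,
      _, sub_smul_map_mem_complexSubspace hJ ι (-ε) w, ?_⟩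
    rw [Units.neg_smul]
    abel

theorem op_smul_mem_complexSubspace_neg {ι : ImagUnit} {ε : ℤˣ} {p : ℍ}
    (hp : SemiconjBy p (ι : ℍ) (-(ι : ℍ))) {u : H} (hu : u ∈ complexSubspace J ι ε) :
    MulOpposite.op p • u ∈ complexSubspace J ι (-ε) := by
  have hJu : J u = ε • (MulOpposite.op (ι : ℍ) • u) := hu
  change J _ = _
  rw [map_smul, hJu, smul_comm, smul_smul, smul_smul, ← MulOpposite.op_mul, ← MulOpposite.op_mul,
    ← neg_neg (ι * p : ℍ), ← neg_mul, ← hp.eq, MulOpposite.op_neg, neg_smul,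
    Units.neg_smul, smul_neg]

theorem bijOn_complexSubspace_neg {ι : ImagUnit} {ε : ℤˣ}
    (hD : BijOn D (complexSubspace J ι ε) (complexSubspace J ι ε)) :
    BijOn D (complexSubspace J ι (-ε)) (complexSubspace J ι (-ε)) := by
  obtain ⟨p, hp0, hp⟩ := exists_ne_zero_semiconjBy_neg ι
  have hp' : SemiconjBy p⁻¹ (ι : ℍ) (-(ι : ℍ)) := by simpa using hp.inv_symm_left₀.neg_right
  have cancel_left (u : H) : MulOpposite.op p⁻¹ • MulOpposite.op p • u = u := by
    rw [MulOpposite.op_inv, inv_smul_smul₀ (MulOpposite.op_ne_zero_iff p |>.2 hp0)]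
  have cancel_right (u : H) : MulOpposite.op p • MulOpposite.op p⁻¹ • u = u := by
    rw [MulOpposite.op_inv, smul_inv_smul₀ (MulOpposite.op_ne_zero_iff p |>.2 hp0)]
  have mapsTo {q : ℍ} (hq : SemiconjBy q (ι : ℍ) (-(ι : ℍ))) :
      MapsTo (MulOpposite.op q • · : H → H) (complexSubspace J ι (-ε)) (complexSubspace J ι ε) :=
    fun u hu => neg_neg ε ▸ op_smul_mem_complexSubspace_neg hq hu
  have bijOn : BijOn (MulOpposite.op p • · : H → H) (complexSubspace J ι ε)
      (complexSubspace J ι (-ε)) :=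
    InvOn.bijOn ⟨fun u _ => cancel_left u, fun u _ => cancel_right u⟩
      (fun _ => op_smul_mem_complexSubspace_neg hp) (mapsTo hp')
  have bijOn' : BijOn (MulOpposite.op p⁻¹ • · : H → H) (complexSubspace J ι (-ε))
      (complexSubspace J ι ε) :=
    InvOn.bijOn ⟨fun u _ => cancel_right u, fun u _ => cancel_left u⟩
      (mapsTo hp') (fun _ => op_smul_mem_complexSubspace_neg hp)
  refine ((bijOn.comp hD).comp bijOn').congr fun u _ => ?_
  change MulOpposite.op p • D (MulOpposite.op p⁻¹ • u) = D u
  rw [map_smul, cancel_right]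

theorem bijOn_complexSubspace_iff_bijective (hJ : J * J = -1) (hD : Commute D J) {ι : ImagUnit}
    {ε : ℤˣ} :
    BijOn D (complexSubspace J ι ε) (complexSubspace J ι ε) ↔ Bijective D := by
  rw [bijective_iff_bijOn_of_isCompl (isCompl_complexSubspace_neg hJ ι ε)
    (fun _ => map_mem_complexSubspace hD) (fun _ => map_mem_complexSubspace hD)]
  exact ⟨fun h => ⟨h, bijOn_complexSubspace_neg h⟩, And.left⟩

end ComplexSubspaces

section Spectrum

open Function Set

variable {H : Type*} [NormedAddCommGroup H] [Module ℍᵐᵒᵖ H] [QuaternionicInnerProductSpace H]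
  {J T D : H →L[ℍᵐᵒᵖ] H} {ι : ImagUnit} {ε : ℤˣ}

theorem bijective_iff_denseRange_and_exists_bound [CompleteSpace H] :
    Bijective D ↔ DenseRange D ∧ ∃ K : ℝ, ∀ u, ‖u‖ ≤ K * ‖D u‖ := by
  let _ : InnerProductSpace ℝ H := realInnerProductSpace H
  let R : H →L[ℝ] H :=
    { toFun := D
      map_add' := D.map_add
      map_smul' := fun r u => D.map_smul (MulOpposite.op (r : ℍ)) u
      cont := D.continuous }
  have hdense : R.range.topologicalClosure = ⊤ ↔ DenseRange D :=
    Submodule.dense_iff_topologicalClosure_eq_top.symm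
  have hbound : (∃ c, AntilipschitzWith c R) ↔ ∃ K : ℝ, ∀ u, ‖u‖ ≤ K * ‖D u‖ := by
    constructor
    · rintro ⟨c, hc⟩
      exact ⟨c, fun u => hc.le_mul_norm (map_zero R) u⟩
    · rintro ⟨K, hK⟩
      refine ⟨K.toNNReal, AddMonoidHomClass.antilipschitz_of_bound R fun u => ?_⟩
      exact (hK u).trans (mul_le_mul_of_nonneg_right (Real.le_coe_toNNReal K) (norm_nonneg _))
  rw [← hdense, ← hbound]
  exact R.bijective_iff_dense_range_and_antilipschitz

theorem mem_sphericalSpectrum_iff_not_bijective [CompleteSpace H] {q : ℍ} :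
    q ∈ sphericalSpectrum T ↔ ¬ Bijective (sphericalDelta q T) := by
  refine not_congr ⟨fun h => bijective_iff_denseRange_and_exists_bound.2 h.2, fun h => ?_⟩
  exact ⟨(injective_iff_map_eq_zero _).1 h.1, bijective_iff_denseRange_and_exists_bound.1 h⟩

theorem commute_realScalar (r : ℝ) (T : H →L[ℍᵐᵒᵖ] H) : Commute (realScalar H r) T :=
  ContinuousLinearMap.ext fun u => (T.map_smul (MulOpposite.op (r : ℍ)) u).symm

theorem commute_sphericalDelta (hTJ : Commute T J) (q : ℍ) : Commute (sphericalDelta q T) J :=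
  ((hTJ.mul_left hTJ).sub_left (hTJ.mul_left (commute_realScalar _ J))).add_left
    (commute_realScalar _ J)

theorem bijective_restrict_iff_bijOn
    (h : ∀ u ∈ complexSubspace J ι ε, D u ∈ complexSubspace J ι ε) :
    Bijective (restrict J ι ε D h) ↔ BijOn D (complexSubspace J ι ε) (complexSubspace J ι ε) :=
  ⟨fun hD => ⟨h, (MapsTo.restrict_inj h).1 hD.1, (MapsTo.restrict_surjective_iff h).1 hD.2⟩,
    fun hD => hD.bijective⟩

theorem restrict_sphericalDelta_toSlice
    (h : ∀ u ∈ complexSubspace J ι ε, T u ∈ complexSubspace J ι ε) (j : ImagUnit) (z : ℂ)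
    (hΔ : ∀ u ∈ complexSubspace J ι ε,
      sphericalDelta (toSlice j z) T u ∈ complexSubspace J ι ε) :
    restrict J ι ε (sphericalDelta (toSlice j z) T) hΔ
      = restrict J ι ε T h * restrict J ι ε T h
        - (z + starRingEnd ℂ z) • restrict J ι ε T h
        + algebraMap ℂ _ (z * starRingEnd ℂ z) := by
  ext u
  rw [Complex.add_conj, Complex.mul_conj, Complex.normSq_eq_norm_sq]
  change T (T u) - T (MulOpposite.op ((toSlice j z + star (toSlice j z)).re : ℍ) • (u : H))
      + MulOpposite.op ((‖toSlice j z‖ ^ 2 : ℝ) : ℍ) • (u : H)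
    = T (T u) - MulOpposite.op (toSlice ι ((2 * z.re : ℝ) : ℂ)) • T u
      + MulOpposite.op (toSlice ι ((‖z‖ ^ 2 : ℝ) : ℂ)) • (u : H)
  rw [toSlice_add_star, norm_toSlice, toSlice_ofReal, toSlice_ofReal, Quaternion.re_coe, map_smul]

theorem preimage_toSlice_sphericalSpectrum [CompleteSpace H] (hJ : J * J = -1)
    (hTJ : Commute T J) (h : ∀ u ∈ complexSubspace J ι ε, T u ∈ complexSubspace J ι ε)
    (j : ImagUnit) :
    toSlice j ⁻¹' sphericalSpectrum T
      = spectrum ℂ (restrict J ι ε T h) ∪ starRingEnd ℂ '' spectrum ℂ (restrict J ι ε T h) := by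
  ext z
  have hΔ := commute_sphericalDelta hTJ (toSlice j z)
  rw [mem_preimage, mem_sphericalSpectrum_iff_not_bijective,
    ← bijOn_complexSubspace_iff_bijective hJ hΔ (ι := ι) (ε := ε),
    ← bijective_restrict_iff_bijOn fun _ => map_mem_complexSubspace hΔ,
    ← ContinuousLinearMap.isUnit_iff_bijective, restrict_sphericalDelta_toSlice h,
    isUnit_mul_self_sub_add_iff_notMem_spectrum, ← not_or, not_not, mem_union,
    Involutive.image_eq_preimage_symm Complex.conj_conj, mem_preimage]

theorem adjoint_restrict [CompleteSpace H]
    (h : ∀ u ∈ complexSubspace J ι ε, T u ∈ complexSubspace J ι ε)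
    (h' : ∀ u ∈ complexSubspace J ι ε, adjoint T u ∈ complexSubspace J ι ε) :
    ContinuousLinearMap.adjoint (restrict J ι ε T h) = restrict J ι ε (adjoint T) h' :=
  Eq.symm <| (ContinuousLinearMap.eq_adjoint_iff _ _).2 fun u v =>
    congrArg (ofSlice ι) (adjoint_inner_left T (u : H) (v : H))

end Spectrum

end QuaternionicHilbert

theorem mainTheorem6_general {H : Type*} [NormedAddCommGroup H] [Module ℍᵐᵒᵖ H]
    [QuaternionicInnerProductSpace H] [CompleteSpace H]
    (T J : H →L[ℍᵐᵒᵖ] H)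
    (hJ : J * J = -1)
    (hTJ : T * J = J * T)
    (hTJ' : QuaternionicHilbert.adjoint T * J = J * QuaternionicHilbert.adjoint T)
    (ι : QuaternionicHilbert.ImagUnit) (ε : ℤˣ) :
    ∃ (h : ∀ u ∈ QuaternionicHilbert.complexSubspace J ι ε,
          T u ∈ QuaternionicHilbert.complexSubspace J ι ε)
      (h' : ∀ u ∈ QuaternionicHilbert.complexSubspace J ι ε,
          QuaternionicHilbert.adjoint T u ∈ QuaternionicHilbert.complexSubspace J ι ε),
      ContinuousLinearMap.adjoint (QuaternionicHilbert.restrict J ι ε T h)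
          = QuaternionicHilbert.restrict J ι ε (QuaternionicHilbert.adjoint T) h' ∧
      QuaternionicHilbert.toSlice ι ''
          (spectrum ℂ (QuaternionicHilbert.restrict J ι ε T h) ∪
            (starRingEnd ℂ) '' spectrum ℂ (QuaternionicHilbert.restrict J ι ε T h))
        = QuaternionicHilbert.sphericalSpectrum T ∩ QuaternionicHilbert.slice ι ∧
      QuaternionicHilbert.sphericalSpectrum T
        = QuaternionicHilbert.circularization
            (spectrum ℂ (QuaternionicHilbert.restrict J ι ε T h)) := by
  have hT := fun u => QuaternionicHilbert.map_mem_complexSubspace (ι := ι) (ε := ε) (u := u) hTJ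
  have hspec := QuaternionicHilbert.preimage_toSlice_sphericalSpectrum hJ hTJ hT
  refine ⟨hT, fun u => QuaternionicHilbert.map_mem_complexSubspace hTJ',
    QuaternionicHilbert.adjoint_restrict _ _, ?_,
    QuaternionicHilbert.eq_circularization_of_preimage_toSlice hspec⟩
  rw [← hspec ι, Set.image_preimage_eq_inter_range, QuaternionicHilbert.slice_eq_range_toSlice]

theorem mainTheorem6 {H : Type*} [NormedAddCommGroup H] [Module ℍᵐᵒᵖ H]
    [QuaternionicInnerProductSpace H] [CompleteSpace H]
    (T J : H →L[ℍᵐᵒᵖ] H)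
    (hT : T * QuaternionicHilbert.adjoint T = QuaternionicHilbert.adjoint T * T)
    (hJ : QuaternionicHilbert.adjoint J = -J)
    (hJu : J * QuaternionicHilbert.adjoint J = 1 ∧ QuaternionicHilbert.adjoint J * J = 1)
    (hTJ : T * J = J * T)
    (hTJ' : QuaternionicHilbert.adjoint T * J = J * QuaternionicHilbert.adjoint T)
    (ι : QuaternionicHilbert.ImagUnit) (ε : ℤˣ) :
    ∃ (h : ∀ u ∈ QuaternionicHilbert.complexSubspace J ι ε,
          T u ∈ QuaternionicHilbert.complexSubspace J ι ε)
      (h' : ∀ u ∈ QuaternionicHilbert.complexSubspace J ι ε,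
          QuaternionicHilbert.adjoint T u ∈ QuaternionicHilbert.complexSubspace J ι ε),
      ContinuousLinearMap.adjoint (QuaternionicHilbert.restrict J ι ε T h)
          = QuaternionicHilbert.restrict J ι ε (QuaternionicHilbert.adjoint T) h' ∧
      QuaternionicHilbert.toSlice ι ''
          (spectrum ℂ (QuaternionicHilbert.restrict J ι ε T h) ∪
            (starRingEnd ℂ) '' spectrum ℂ (QuaternionicHilbert.restrict J ι ε T h))
        = QuaternionicHilbert.sphericalSpectrum T ∩ QuaternionicHilbert.slice ι ∧
      QuaternionicHilbert.sphericalSpectrum T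
        = QuaternionicHilbert.circularization
            (spectrum ℂ (QuaternionicHilbert.restrict J ι ε T h)) := by
  have hJJ : J * J = -1 := neg_eq_iff_eq_neg.1 (by rw [← mul_neg, ← hJ, hJu.1])
  exact mainTheorem6_general T J hJJ hTJ hTJ' ι ε
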